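/- Let $G\subset \mathrm{GL}_N(\mathbb{C})$ be a connected reductive linear algebraic group with Lie algebra $\mathfrak{g}$, let $k\ge 0$, and let $$H\,dz=\Bigl(\frac{H_k}{z^k}+\cdots+\frac{H_1}{z}+H_{\mathrm{res}}\Bigr)\frac{dz}{z}$$ be an unramified canonical form: $H_i,H_{\mathrm{res}}\in\mathfrak{g}$ commute pairwise and $H_1,\dots,H_k$ are semisimple. Let $H_{\mathrm{res}}=H_0+J_0$ be the Jordan decomposition ($H_0$ semisimple, $J_0$ nilpotent). Fix a Cartan subalgebra (maximal toral subalgebra) $\mathfrak{t}\subset\mathfrak{g}$ containing $H_0,\dots,H_k$, with root set $\Phi$, and a system $\Pi\subset\Phi$ of simple roots. Put $$\Pi_i:=\{\alpha\in\Pi\mid \alpha(H_k)=\cdots=\alpha(H_i)=0\}\quad(0\le i\le k),\qquad \Pi_{k+1}:=\Pi .$$ Assume, as the Weyl group allows, that $H$ is normalized: for $i=k,k-1,\dots,0$ and all $\alpha\in\Pi_{i+1}$ one has $\mathrm{Re}\,\alpha(H_i)\ge 0$, and $\mathrm{Im}\,\alpha(H_i)\ge 0$ if $\mathrm{Re}\,\alpha(H_i)=0$.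 For a sequence $P_m\supset\cdots\supset P_0$ of subsets of $\Pi$ (with $P_{m+1}:=\Pi$) and a nilpotent $J$, write $(P_m\supset\cdots\supset P_0;[J])$ for the pair of the sequence and the orbit $[J]$ of $J$ under the adjoint action of the Levi subgroup $L_1\subset G$ that belongs to $P_1$, i.e. the analytic subgroup with Lie algebra $\mathfrak{t}\oplus\bigoplus_{\alpha\in\Phi\cap\mathbb{Z}P_1}\mathfrak{g}_\alpha$. The spectral type of $H$ with respect to $(\mathfrak{t},\Pi)$ is $(\Pi_k\supset\cdots\supset\Pi_0;[J_0])$. The spectral type with respect to $(\mathfrak{t},\Pi)$ of any canonical form $\sum_{\nu=0}^{m}A_\nu(z-a)^{-\nu-1}dz$ at a point $a$ is given in the same way by the sets $\{\alpha\in\Pi\mid\alpha((A_\mu)_{\mathrm{ss}})=0\text{ for all }\mu\ge\nu\}$, $0\le \nu\le m$, and the nilpotent part of $A_0$, whenever the semisimple parts $(A_\mu)_{\mathrm{ss}}$ lie in $\mathfrak{t}$. For $\alpha\in\Pi\setminus\Pi_0$ let $d(\alpha):=\max\{i\in\{0,\dots,k\}\mid\alpha\notin\Pi_i\}$ and $$f_\alpha^{(i)}(x_0,\dots,x_k):=\sum_{j=i}^{d(\alpha)}\alpha(H_j)\prod_{\nu=j+1}^{d(\alpha)}(x_i-x_\nu)\qquad(0\le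 i\le d(\alpha)),$$ and let $\mathbb{B}_H\subset\mathbb{C}^{k+1}$ be the set of all $\mathbf{c}$ with $f_\alpha^{(i)}(\mathbf{c})\ne 0$ for all $\alpha\in\Pi\setminus\Pi_0$ and $0\le i\le d(\alpha)$. The unfolding of $H$ is $$H(\mathbf{c}):=\frac{H_{\mathrm{res}}}{z-c_0}+\sum_{i=1}^{k}\frac{H_i}{(z-c_0)(z-c_1)\cdots(z-c_i)}\in\mathfrak{g}\otimes\mathbb{C}(z).$$ Let $I_0\sqcup\cdots\sqcup I_r=\{0,1,\dots,k\}$ be a partition $\mathcal{I}$ into nonempty sets with $0\in I_0$, write $I_j=\{i_{[j,0]}<\cdots<i_{[j,k_j]}\}$, and let $C(\mathcal{I})\subset\mathbb{C}^{k+1}$ be the stratum of all $\mathbf{c}$ such that $c_i=c_{i'}$ if and only if $i$ and $i'$ lie in the same part. Suppose $\mathbf{c}\in\mathbb{B}_H\cap C(\mathcal{I})$. Then $H(\mathbf{c})$ has a unique partial fraction decomposition $$H(\mathbf{c})=\sum_{j=0}^{r}H(\mathbf{c})_j,\qquad H(\mathbf{c})_j=\sum_{\nu=0}^{k_j}\frac{A^{[j]}_\nu}{(z-c_{i_{[j,0]}})^{\nu+1}},\quad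 A^{[j]}_\nu\in\mathfrak{g};$$ each $H(\mathbf{c})_j$ is a canonical form at $z=c_{i_{[j,0]}}$, the semisimple parts of whose coefficients lie in $\mathfrak{t}$; and its spectral type with respect to $(\mathfrak{t},\Pi)$ is $$(\Pi_{i_{[0,k_0]}}\supset\cdots\supset\Pi_{i_{[0,0]}};[J_0])\ \text{ for } j=0,\qquad (\Pi_{i_{[j,k_j]}}\supset\cdots\supset\Pi_{i_{[j,0]}};[0])\ \text{ for } 1\le j\le r .$$ -/

import Mathlib

open scoped TensorProduct

attribute [local instance 100] LieRing.ofAssociativeRing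

noncomputable section

namespace Unfolding

/-- `N × N` complex matrices. -/
abbrev Mat (N : ℕ) : Type := Matrix (Fin N) (Fin N) ℂ

variable {N : ℕ}

/-! ### Linear algebraic groups over `ℂ`, embedded in `GL N` -/

/-- Value at the matrix `A` of a polynomial in the `N * N` matrix entries. -/
def evalAt (A : Mat N) (p : MvPolynomial (Fin N × Fin N) ℂ) : ℂ :=
  MvPolynomial.eval (fun e => A e.1 e.2) p

/-- Zariski closed subsets of `GL N`. (Zero loci of polynomials in the entries; denominators `det`
can be cleared, as `det` is invertible on `GL N`.) -/
def IsZariskiClosed (S : Set (GL (Fin N) ℂ)) : Prop :=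
  ∃ P : Set (MvPolynomial (Fin N × Fin N) ℂ),
    S = {g : GL (Fin N) ℂ | ∀ p ∈ P, evalAt (g : Mat N) p = 0}

/-- Connectedness of a subgroup of `GL N` in the Zariski topology. -/
def IsZariskiConnected (G : Subgroup (GL (Fin N) ℂ)) : Prop :=
  ∀ A B : Set (GL (Fin N) ℂ), IsZariskiClosed A → IsZariskiClosed B →
    A ∪ B = (G : Set (GL (Fin N) ℂ)) → Disjoint A B → A = ∅ ∨ B = ∅

/-- All elements of the subgroup are unipotent matrices. -/
def IsUnipotentSubgroup (U : Subgroup (GL (Fin N) ℂ)) : Prop :=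
  ∀ u ∈ U, IsNilpotent ((u : Mat N) - 1)

/-- `G ⊆ GL N` is a connected reductive linear algebraic group: it is Zariski closed, connected,
and its unipotent radical is trivial. -/
structure IsConnectedReductive (G : Subgroup (GL (Fin N) ℂ)) : Prop where
  closed : IsZariskiClosed (G : Set (GL (Fin N) ℂ))
  connected : IsZariskiConnected G
  reductive : ∀ U : Subgroup (GL (Fin N) ℂ), U ≤ G →
    IsZariskiClosed (U : Set (GL (Fin N) ℂ)) → IsZariskiConnected U →
    (∀ g ∈ G, ∀ u ∈ U, g * u * g⁻¹ ∈ U) → IsUnipotentSubgroup U → U = ⊥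

/-- The derivation of the polynomial ring given by the left invariant vector field
`A ↦ A * X`, i.e. `f ↦ (A ↦ d/ds f (A * (1 + s X)))` at `s = 0`. -/
def leftInvDer (X : Mat N) :
    Derivation ℂ (MvPolynomial (Fin N × Fin N) ℂ) (MvPolynomial (Fin N × Fin N) ℂ) :=
  MvPolynomial.mkDerivation ℂ fun e =>
    ∑ l, MvPolynomial.C (X l e.2) * MvPolynomial.X (e.1, l)

/-- Left translation of a polynomial function: `f ↦ (A ↦ f (h * A))`. -/
def translate (h : Mat N) :
    MvPolynomial (Fin N × Fin N) ℂ →ₐ[ℂ] MvPolynomial (Fin N × Fin N) ℂ :=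
  MvPolynomial.aeval fun e => ∑ l, MvPolynomial.C (h e.1 l) * MvPolynomial.X (l, e.2)

theorem evalAt_translate (h A : Mat N) (p : MvPolynomial (Fin N × Fin N) ℂ) :
    evalAt A (translate h p) = evalAt (h * A) p := by
  induction p using MvPolynomial.induction_on with
  | C a => simp [evalAt, translate]
  | add p q hp hq => simp_all [evalAt]
  | mul_X p e hp => simp_all [evalAt, translate, Matrix.mul_apply]

theorem leftInvDer_X (X : Mat N) (e : Fin N × Fin N) :
    leftInvDer X (MvPolynomial.X e) =
      ∑ l, MvPolynomial.C (X l e.2) * MvPolynomial.X (e.1, l) := by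
  simp [leftInvDer]

theorem evalAt_mul_leftInvDer (h X A : Mat N) (p : MvPolynomial (Fin N × Fin N) ℂ) :
    evalAt A (leftInvDer X (translate h p)) = evalAt (h * A) (leftInvDer X p) := by
  induction p using MvPolynomial.induction_on with
  | C a => simp [evalAt, translate]
  | add p q hp hq => simp_all [evalAt]
  | mul_X p e hp =>
    have hX : evalAt A (leftInvDer X (translate h (MvPolynomial.X e))) =
        evalAt (h * A) (leftInvDer X (MvPolynomial.X e)) := by
      simp only [translate, MvPolynomial.aeval_X, map_sum, Derivation.leibniz, leftInvDer_X,
        MvPolynomial.derivation_C, evalAt, smul_eq_mul, map_mul, mul_zero, add_zero,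
        MvPolynomial.eval_C, MvPolynomial.eval_X, Matrix.mul_apply, Finset.mul_sum]
      rw [Finset.sum_comm]
      refine Finset.sum_congr rfl fun i _ => Finset.sum_congr rfl fun j _ => ?_
      ring
    have h1 := evalAt_translate h A p
    have h2 := evalAt_translate h A (MvPolynomial.X e)
    simp only [evalAt, map_mul, Derivation.leibniz, smul_eq_mul, map_add] at *
    rw [hp, hX, h1, h2]

theorem leftInvDer_lie (X Y : Mat N) :
    leftInvDer ⁅X, Y⁆ = ⁅leftInvDer X, leftInvDer Y⁆ := by
  refine MvPolynomial.derivation_ext fun e => ?_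
  have h : ∀ A B : Mat N, leftInvDer A (leftInvDer B (MvPolynomial.X e)) =
      ∑ l, MvPolynomial.C ((A * B) l e.2) * MvPolynomial.X (e.1, l) := by
    intro A B
    simp only [leftInvDer_X, map_sum, Derivation.leibniz, MvPolynomial.derivation_C, smul_eq_mul,
      mul_zero, add_zero, Finset.mul_sum, Matrix.mul_apply, Finset.sum_mul, map_mul]
    rw [Finset.sum_comm]
    refine Finset.sum_congr rfl fun i _ => Finset.sum_congr rfl fun j _ => ?_
    ring
  rw [Derivation.commutator_apply, h, h, leftInvDer_X, ← Finset.sum_sub_distrib]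
  refine Finset.sum_congr rfl fun l _ => ?_
  rw [LieRing.of_associative_ring_bracket, Matrix.sub_apply, map_sub, sub_mul]

theorem leftInvDer_add (X Y : Mat N) :
    leftInvDer (X + Y) = leftInvDer X + leftInvDer Y := by
  refine MvPolynomial.derivation_ext fun e => ?_
  simp [leftInvDer_X, add_mul, Finset.sum_add_distrib]

theorem leftInvDer_smul (a : ℂ) (X : Mat N) :
    leftInvDer (a • X) = a • leftInvDer X := by
  refine MvPolynomial.derivation_ext fun e => ?_
  simp [leftInvDer_X, Finset.smul_sum, MvPolynomial.smul_eq_C_mul, mul_assoc]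

/-- The Lie algebra of `G ⊆ GL N`, as a Lie subalgebra of `gl N` with the commutator bracket: the
tangent space at the identity, i.e. all `X` such that `d/ds f (1 + s X) = 0` at `s = 0` for every
polynomial `f` that vanishes on `G`. -/
def lieAlg (G : Subgroup (GL (Fin N) ℂ)) : LieSubalgebra ℂ (Mat N) where
  carrier := {X | ∀ f : MvPolynomial (Fin N × Fin N) ℂ,
    (∀ g ∈ G, evalAt (g : Mat N) f = 0) → evalAt 1 (leftInvDer X f) = 0}
  zero_mem' := by
    intro f _
    have := leftInvDer_smul (0 : ℂ) (0 : Mat N)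
    simp only [zero_smul] at this
    simp [this, evalAt]
  add_mem' := by
    intro X Y hX hY f hf
    have h1 := hX f hf
    have h2 := hY f hf
    simp only [evalAt] at h1 h2
    simp [leftInvDer_add, evalAt, h1, h2]
  smul_mem' := by
    intro a X hX f hf
    have h1 := hX f hf
    simp only [evalAt] at h1
    simp [leftInvDer_smul, evalAt, MvPolynomial.smul_eval, h1]
  lie_mem' := by
    intro X Y hX hY f hf
    have key : ∀ Z : Mat N,
        (∀ f : MvPolynomial (Fin N × Fin N) ℂ,
          (∀ g ∈ G, evalAt (g : Mat N) f = 0) → evalAt 1 (leftInvDer Z f) = 0) →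
        ∀ g ∈ G, evalAt (g : Mat N) (leftInvDer Z f) = 0 := by
      intro Z hZ g hg
      have h1 := evalAt_mul_leftInvDer (g : Mat N) Z 1 f
      rw [mul_one] at h1
      rw [← h1]
      refine hZ _ fun g' hg' => ?_
      rw [evalAt_translate]
      simpa using hf (g * g') (G.mul_mem hg hg')
    have h1 := hX _ (key Y hY)
    have h2 := hY _ (key X hX)
    simp only [evalAt] at h1 h2
    simp [leftInvDer_lie, Derivation.commutator_apply, evalAt, h1, h2]

/-! ### Jordan decomposition -/

/-- Semisimple (i.e. diagonalizable) matrices. -/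
def IsSemisimpleMat (X : Mat N) : Prop := Module.End.IsSemisimple (Matrix.toLin' X)

/-- `X = S + J` is the (additive) Jordan decomposition of `X`. -/
structure IsJordanDecomposition (X S J : Mat N) : Prop where
  semisimple : IsSemisimpleMat S
  nilpotent : IsNilpotent J
  commute : Commute S J
  eq_add : X = S + J

theorem exists_jordan (X : Mat N) : ∃ q : Mat N × Mat N, IsJordanDecomposition X q.1 q.2 := by
  obtain ⟨n, hn, s, hs, hnil, hss, h⟩ :=
    Module.End.exists_isNilpotent_isSemisimple (f := Matrix.toLin' X)
  have hc : Commute s n :=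
    Algebra.commute_of_mem_adjoin_singleton_of_commute hn
      (Algebra.commute_of_mem_adjoin_self hs).symm
  refine ⟨(LinearMap.toMatrixAlgEquiv' s, LinearMap.toMatrixAlgEquiv' n), ?_, ?_, ?_, ?_⟩
  · have h1 : Matrix.toLin' (LinearMap.toMatrixAlgEquiv' s) = s := Matrix.toLin'_toMatrix' s
    rw [IsSemisimpleMat, h1]
    exact hss
  · exact hnil.map LinearMap.toMatrixAlgEquiv'
  · exact hc.map LinearMap.toMatrixAlgEquiv'
  · have h2 : X = LinearMap.toMatrixAlgEquiv' (Matrix.toLin' X) :=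
      (LinearMap.toMatrix'_toLin' X).symm
    calc X = LinearMap.toMatrixAlgEquiv' (Matrix.toLin' X) := h2
      _ = LinearMap.toMatrixAlgEquiv' (s + n) := by rw [h, add_comm]
      _ = _ := map_add _ _ _

/-- Semisimple part in the Jordan decomposition. -/
def ssPart (X : Mat N) : Mat N := (exists_jordan X).choose.1

/-- Nilpotent part in the Jordan decomposition. -/
def nilPart (X : Mat N) : Mat N := (exists_jordan X).choose.2

theorem isJordanDecomposition_parts (X : Mat N) :
    IsJordanDecomposition X (ssPart X) (nilPart X) := (exists_jordan X).choose_spec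

/-! ### Cartan subalgebras, roots, simple systems, Levi subgroups -/

/-- `t` is a maximal toral subalgebra (a Cartan subalgebra) of the Lie algebra of `G`. -/
def IsMaximalToral (G : Subgroup (GL (Fin N) ℂ)) (t : LieSubalgebra ℂ (Mat N)) : Prop :=
  Maximal (fun s : LieSubalgebra ℂ (Mat N) => s ≤ lieAlg G ∧ ∀ X ∈ s, IsSemisimpleMat X) t

/-- The simultaneous eigenspace of `t` in the Lie algebra of `G` for the functional `α`. -/
def rootSpace (G : Subgroup (GL (Fin N) ℂ)) (t : LieSubalgebra ℂ (Mat N))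
    (α : Module.Dual ℂ t) : Submodule ℂ (Mat N) where
  carrier := {X | X ∈ lieAlg G ∧ ∀ T : t, ⁅(T : Mat N), X⁆ = α T • X}
  zero_mem' := ⟨(lieAlg G).zero_mem, by simp⟩
  add_mem' := fun hX hY =>
    ⟨(lieAlg G).add_mem hX.1 hY.1, fun T => by rw [lie_add, hX.2, hY.2, smul_add]⟩
  smul_mem' := fun a _ hX =>
    ⟨(lieAlg G).smul_mem a hX.1, fun T => by rw [lie_smul, hX.2, smul_comm]⟩

/-- The set of roots of the Lie algebra of `G` with respect to `t`. -/
def roots (G : Subgroup (GL (Fin N) ℂ)) (t : LieSubalgebra ℂ (Mat N)) :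
    Set (Module.Dual ℂ t) :=
  {α | α ≠ 0 ∧ rootSpace G t α ≠ ⊥}

/-- `Δ` is a system of simple roots: linearly independent roots such that each root is a sum of
elements of `Δ` or the negative of such a sum. -/
structure IsSimpleSystem (G : Subgroup (GL (Fin N) ℂ)) (t : LieSubalgebra ℂ (Mat N))
    (Δ : Set (Module.Dual ℂ t)) : Prop where
  subset : Δ ⊆ roots G t
  linearIndepOn : LinearIndepOn ℂ id Δ
  pos_or_neg : ∀ α ∈ roots G t, α ∈ AddSubmonoid.closure Δ ∨ -α ∈ AddSubmonoid.closure Δ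

/-- The subspace `t ⊕ ⨁ 𝔤_α`, where `α` runs over the roots in the `ℤ`-span of `Δ'`. -/
def leviAlg (G : Subgroup (GL (Fin N) ℂ)) (t : LieSubalgebra ℂ (Mat N))
    (Δ' : Set (Module.Dual ℂ t)) : Submodule ℂ (Mat N) :=
  t.toSubmodule ⊔
    ⨆ α ∈ {α | α ∈ roots G t ∧ α ∈ AddSubgroup.closure Δ'}, rootSpace G t α

/-- The analytic subgroup with Lie algebra `leviAlg G t Δ'`, i.e. the group generated by the
exponentials of its elements. -/
def leviGroup (G : Subgroup (GL (Fin N) ℂ)) (t : LieSubalgebra ℂ (Mat N))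
    (Δ' : Set (Module.Dual ℂ t)) : Subgroup (GL (Fin N) ℂ) :=
  Subgroup.closure {g | ∃ X ∈ leviAlg G t Δ', (g : Mat N) = NormedSpace.exp X}

/-- The orbit of `J` under the adjoint action (conjugation) of `L`. -/
def adOrbit (L : Subgroup (GL (Fin N) ℂ)) (J : Mat N) : Set (Mat N) :=
  {Y | ∃ g ∈ L, Y = (g : Mat N) * J * ((g⁻¹ : GL (Fin N) ℂ) : Mat N)}

/-! ### Canonical forms and their spectral types -/

/-- An unramified canonical form `(H_k / z^k + ⋯ + H_1 / z + H_res) dz / z` with coefficients in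
the Lie algebra of `G`, recorded through its coefficients: `coeff 0 = H_res`, and `coeff i = H_i`
for `1 ≤ i`. The same data stand for a canonical form at any other point `a`, with `z - a` in place
of `z`. -/
structure CanonicalForm (G : Subgroup (GL (Fin N) ℂ)) (k : ℕ) where
  coeff : Fin (k + 1) → lieAlg G
  semisimple : ∀ i, i ≠ 0 → IsSemisimpleMat (coeff i : Mat N)
  lie_eq_zero : ∀ i j, ⁅coeff i, coeff j⁆ = 0

namespace CanonicalForm

variable {G : Subgroup (GL (Fin N) ℂ)} {k : ℕ}

/-- The elements `H_k, …, H_1, H_0`, where `H_res = H_0 + J_0` is the Jordan decomposition: the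
semisimple parts of the coefficients (for `1 ≤ i` the coefficient is itself semisimple). -/
def ss (H : CanonicalForm G k) (i : Fin (k + 1)) : Mat N := ssPart (H.coeff i : Mat N)

/-- The nilpotent part `J_0` of `H_res`. -/
def nilRes (H : CanonicalForm G k) : Mat N := nilPart (H.coeff 0 : Mat N)

/-- `t` contains `H_0, H_1, …, H_k`. -/
def IsIn (H : CanonicalForm G k) (t : LieSubalgebra ℂ (Mat N)) : Prop := ∀ i, H.ss i ∈ t

/-- The number `α (H_i)`. -/
def rootVal (H : CanonicalForm G k) {t : LieSubalgebra ℂ (Mat N)} (hH : H.IsIn t)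
    (α : Module.Dual ℂ t) (i : Fin (k + 1)) : ℂ := α ⟨H.ss i, hH i⟩

/-- The set of simple roots `Π_i = {α ∈ Δ | α (H_k) = ⋯ = α (H_i) = 0}`. -/
def chain (H : CanonicalForm G k) {t : LieSubalgebra ℂ (Mat N)} (hH : H.IsIn t)
    (Δ : Set (Module.Dual ℂ t)) (i : Fin (k + 1)) : Set (Module.Dual ℂ t) :=
  {α | α ∈ Δ ∧ ∀ m, i ≤ m → H.rootVal hH α m = 0}

end CanonicalForm

/-- A sequence `Π_0, …, Π_k` of sets of simple roots, extended by `Π_i = Δ` for `k < i`. -/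
def extendChain {t : LieSubalgebra ℂ (Mat N)} {k : ℕ} (Δ : Set (Module.Dual ℂ t))
    (P : Fin (k + 1) → Set (Module.Dual ℂ t)) (i : ℕ) : Set (Module.Dual ℂ t) :=
  if h : i < k + 1 then P ⟨i, h⟩ else Δ

/-- A pair of a sequence of sets of simple roots and a set of matrices (an adjoint orbit). -/
@[ext]
structure SpectralType (N : ℕ) (t : LieSubalgebra ℂ (Mat N)) (k : ℕ) where
  chain : Fin (k + 1) → Set (Module.Dual ℂ t)
  orbit : Set (Mat N)

/-- The spectral type `(Π_k ⊇ ⋯ ⊇ Π_0; [J])`, where `[J]` is the orbit of `J` under the adjoint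
action of the Levi subgroup `L_1` that belongs to `Π_1` (to `Π_1 = Δ` if `k = 0`). -/
def spectralTypeMk (G : Subgroup (GL (Fin N) ℂ)) {t : LieSubalgebra ℂ (Mat N)} {k : ℕ}
    (Δ : Set (Module.Dual ℂ t)) (P : Fin (k + 1) → Set (Module.Dual ℂ t)) (J : Mat N) :
    SpectralType N t k where
  chain := P
  orbit := adOrbit (leviGroup G t (extendChain Δ P 1)) J

namespace CanonicalForm

variable {G : Subgroup (GL (Fin N) ℂ)} {k : ℕ}

/-- The spectral type of a canonical form with respect to the Cartan subalgebra `t` and the simple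
system `Δ`. -/
def spectralType (H : CanonicalForm G k) {t : LieSubalgebra ℂ (Mat N)} (hH : H.IsIn t)
    (Δ : Set (Module.Dual ℂ t)) : SpectralType N t k :=
  spectralTypeMk G Δ (H.chain hH Δ) H.nilRes

/-- The normalization that the Weyl group allows: `H_k` is in the fundamental domain
`{X | Re α(X) ≥ 0, and Im α(X) ≥ 0 if Re α(X) = 0, for all α ∈ Δ}`, and inductively `H_i` is in the
domain given by the same conditions for all `α ∈ Π_{i+1}`, where `Π_{k+1} = Δ`. -/
def IsNormalized (H : CanonicalForm G k) {t : LieSubalgebra ℂ (Mat N)} (hH : H.IsIn t)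
    (Δ : Set (Module.Dual ℂ t)) : Prop :=
  ∀ i : Fin (k + 1), ∀ α ∈ extendChain Δ (H.chain hH Δ) ((i : ℕ) + 1),
    0 ≤ (H.rootVal hH α i).re ∧
      ((H.rootVal hH α i).re = 0 → 0 ≤ (H.rootVal hH α i).im)

/-! ### The parameter space and the unfolding -/

/-- The value at `c` of the polynomial
`f_α^{(i)} = ∑_{j=i}^{d} α(H_j) ∏_{ν=j+1}^{d} (x_i - x_ν)`. -/
def unfoldPoly (H : CanonicalForm G k) {t : LieSubalgebra ℂ (Mat N)} (hH : H.IsIn t)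
    (α : Module.Dual ℂ t) (d i : Fin (k + 1)) (c : Fin (k + 1) → ℂ) : ℂ :=
  ∑ j ∈ Finset.Icc i d, H.rootVal hH α j * ∏ ν ∈ Finset.Ioc j d, (c i - c ν)

/-- The parameter space `𝔹_H`: all `c` with `f_α^{(i)}(c) ≠ 0` for all `α ∈ Δ \ Π_0` and
`i = 0, …, d(α)`, where `d(α)` is the largest `d` with `α ∉ Π_d`. -/
def paramSpace (H : CanonicalForm G k) {t : LieSubalgebra ℂ (Mat N)} (hH : H.IsIn t)
    (Δ : Set (Module.Dual ℂ t)) : Set (Fin (k + 1) → ℂ) :=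
  {c | ∀ α ∈ Δ \ H.chain hH Δ 0, ∀ d, IsGreatest {i | α ∉ H.chain hH Δ i} d →
    ∀ i ≤ d, H.unfoldPoly hH α d i c ≠ 0}

/-- The unfolding `H(c) = ∑_{i=0}^{k} H_i / ((z - c_0) ⋯ (z - c_i))` (with `H_res` in place of
`H_0`), an element of `𝔤 ⊗ ℂ(z)`. -/
def unfold (H : CanonicalForm G k) (c : Fin (k + 1) → ℂ) : lieAlg G ⊗[ℂ] RatFunc ℂ :=
  ∑ i, H.coeff i ⊗ₜ[ℂ] (∏ l ∈ Finset.Iic i, (RatFunc.X - RatFunc.C (c l)))⁻¹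

end CanonicalForm

/-- The element `∑_{ν=0}^{k} A_ν / (z - a)^{ν+1}` of `𝔤 ⊗ ℂ(z)`. -/
def principalPart {G : Subgroup (GL (Fin N) ℂ)} {k : ℕ} (A : Fin (k + 1) → lieAlg G) (a : ℂ) :
    lieAlg G ⊗[ℂ] RatFunc ℂ :=
  ∑ ν, A ν ⊗ₜ[ℂ] ((RatFunc.X - RatFunc.C a) ^ ((ν : ℕ) + 1))⁻¹

/-! ### Partitions of `{0, …, k}` and strata -/

/-- A partition `I_0 ⊔ ⋯ ⊔ I_r = {0, …, k}` into nonempty parts with `0 ∈ I_0`. The part `I_j` is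
given by its increasing enumeration `idx j 0 < ⋯ < idx j (len j)`. -/
structure IndexPartition (k : ℕ) where
  r : ℕ
  len : Fin (r + 1) → ℕ
  idx : ∀ j : Fin (r + 1), Fin (len j + 1) → Fin (k + 1)
  strictMono : ∀ j, StrictMono (idx j)
  bijective : Function.Bijective fun x : (Σ j : Fin (r + 1), Fin (len j + 1)) => idx x.1 x.2
  zero_mem : 0 ∈ Set.range (idx 0)

/-- The stratum of a partition: `c_i = c_{i'}` exactly if `i` and `i'` are in the same part. -/
def IndexPartition.stratum {k : ℕ} (I : IndexPartition k) : Set (Fin (k + 1) → ℂ) :=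
  {c | ∀ j ν j' ν', c (I.idx j ν) = c (I.idx j' ν') ↔ j = j'}

end Unfolding

end

namespace Unfolding

/-! ### Jordan decompositions of sums of commuting matrices -/

section Jordan

variable {N : ℕ}

/-! The unfolding is linear in the `H_m`, so everything comes from the scalar expansion of `1 / ((z
- c_0) ⋯ (z - c_m))` into elementary fractions. Pairing the fraction of order `ν + 1` at the pole of
`I_j` with the index `i_[j,ν]` makes this expansion triangular: only indices at most `m` occur
(`exists_prod_inv_eq_sum`). Thus each `A^{[j]}_ν` is a combination of the `H_m` with `i_[j,ν] ≤ m`.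
Uniqueness is the linear independence of the fractions.

The coefficients commute, so Jordan decompositions can be taken termwise. `H_res` enters only at
position `(0, 0)`, with coefficient `1`, so `J_0` survives there alone.

Triangularity gives one inclusion between the chains. Conversely, suppose `α(H_m) ≠ 0` for some `m ≥
i_[j,ν]`. Let `d = d(α)`, and let `i = i_[j,μ]` be the last index of `I_j` up to `d`, so `μ ≥ ν`.
Over the denominator `(z - c_0) ⋯ (z - c_d)`, the numerator of `α(H(c))` takes the value
`f_α^{(i)}(c)` at `c_i`. By `eval_numerator` this value is a multiple of `α(A^{[j]}_μ)`. As `c ∈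
𝔹_H` makes it nonzero, `α` does not vanish on `A^{[j]}_μ`. -/

theorem IsSemisimpleMat.zero : IsSemisimpleMat (0 : Mat N) := by
  simp [IsSemisimpleMat]

theorem IsSemisimpleMat.smul {X : Mat N} (hX : IsSemisimpleMat X) (a : ℂ) :
    IsSemisimpleMat (a • X) := by
  rw [IsSemisimpleMat, map_smul]
  exact Module.End.IsSemisimple_smul a hX

theorem IsSemisimpleMat.add {X Y : Mat N} (hX : IsSemisimpleMat X) (hY : IsSemisimpleMat Y)
    (h : Commute X Y) : IsSemisimpleMat (X + Y) := by
  rw [IsSemisimpleMat, map_add]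
  exact Module.End.IsSemisimple.add_of_commute (h.map Matrix.toLinAlgEquiv') hX hY

theorem IsSemisimpleMat.sum {ι : Type*} (s : Finset ι) {X : ι → Mat N}
    (hX : ∀ i, IsSemisimpleMat (X i)) (h : ∀ i j, Commute (X i) (X j)) :
    IsSemisimpleMat (∑ i ∈ s, X i) := by
  classical
  induction s using Finset.induction_on with
  | empty => simpa using IsSemisimpleMat.zero
  | insert i s hi ih =>
    rw [Finset.sum_insert hi]
    exact (hX i).add ih (Commute.sum_right _ _ _ fun j _ => h i j)

theorem IsJordanDecomposition.unique {X S J S' J' : Mat N} (h : IsJordanDecomposition X S J)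
    (h' : IsJordanDecomposition X S' J') : S = S' ∧ J = J' := by
  have h1 := Module.End.isNilpotent_isSemisimple_unique
    (h.nilpotent.map Matrix.toLinAlgEquiv') h.semisimple
    (h'.nilpotent.map Matrix.toLinAlgEquiv') h'.semisimple
    (h.commute.symm.map Matrix.toLinAlgEquiv') (h'.commute.symm.map Matrix.toLinAlgEquiv')
    (by
      have := congrArg (Matrix.toLin') (h.eq_add.symm.trans h'.eq_add)
      rw [map_add, map_add, add_comm, add_comm (Matrix.toLin' S')] at this
      exact this)
  exact ⟨Matrix.toLin'.injective h1.2, Matrix.toLinAlgEquiv'.injective h1.1⟩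

theorem IsJordanDecomposition.ssPart_eq {X S J : Mat N} (h : IsJordanDecomposition X S J) :
    ssPart X = S := ((isJordanDecomposition_parts X).unique h).1

theorem IsJordanDecomposition.nilPart_eq {X S J : Mat N} (h : IsJordanDecomposition X S J) :
    nilPart X = J := ((isJordanDecomposition_parts X).unique h).2

theorem IsSemisimpleMat.isJordanDecomposition {X : Mat N} (h : IsSemisimpleMat X) :
    IsJordanDecomposition X X 0 :=
  ⟨h, IsNilpotent.zero, Commute.zero_right _, (add_zero X).symm⟩

/-- The semisimple part is a polynomial in the matrix. -/
theorem commute_ssPart {X Y : Mat N} (h : Commute Y X) : Commute Y (ssPart X) := by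
  obtain ⟨n, hn, s, hs, hnil, hss, hsum⟩ :=
    Module.End.exists_isNilpotent_isSemisimple (f := Matrix.toLin' X)
  have hc : Commute s n :=
    Algebra.commute_of_mem_adjoin_singleton_of_commute hn
      (Algebra.commute_of_mem_adjoin_self hs).symm
  have hX := isJordanDecomposition_parts X
  have h1 := Module.End.isNilpotent_isSemisimple_unique
    (hX.nilpotent.map Matrix.toLinAlgEquiv') hX.semisimple hnil hss
    (hX.commute.symm.map Matrix.toLinAlgEquiv') hc.symm
    (by
      rw [← hsum]
      -- The first two occurrences of `X` are hidden in `nilPart X` and `ssPart X`; only the bare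
      -- one is expanded.
      nth_rewrite 3 [hX.eq_add]
      rw [map_add, add_comm]
      rfl)
  have h2 : Commute (Matrix.toLinAlgEquiv' Y) s :=
    Algebra.commute_of_mem_adjoin_singleton_of_commute hs (h.map Matrix.toLinAlgEquiv')
  rw [← h1.2] at h2
  have h3 := h2.map (LinearMap.toMatrixAlgEquiv' (R := ℂ) (n := Fin N))
  have h4 : ∀ Z : Mat N, LinearMap.toMatrixAlgEquiv' (Matrix.toLin' Z) = Z :=
    LinearMap.toMatrix'_toLin'
  rw [h4] at h3
  rwa [LinearMap.toMatrixAlgEquiv'_toLinAlgEquiv'] at h3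

theorem commute_nilPart {X Y : Mat N} (h : Commute Y X) : Commute Y (nilPart X) := by
  have hX := (isJordanDecomposition_parts X).eq_add
  rw [show nilPart X = X - ssPart X from (sub_eq_of_eq_add' hX).symm]
  exact h.sub_right (commute_ssPart h)

end Jordan

/-! ### Jordan decompositions of combinations of the coefficients -/

namespace CanonicalForm

variable {N : ℕ} {G : Subgroup (GL (Fin N) ℂ)} {k : ℕ}

theorem commute_coeff (H : CanonicalForm G k) (i j : Fin (k + 1)) :
    Commute (H.coeff i : Mat N) (H.coeff j : Mat N) := by
  have h := congrArg Subtype.val (H.lie_eq_zero i j)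
  rw [LieSubalgebra.coe_bracket, LieRing.of_associative_ring_bracket] at h
  exact sub_eq_zero.mp h

theorem commute_ss (H : CanonicalForm G k) (i j : Fin (k + 1)) : Commute (H.ss i) (H.ss j) :=
  commute_ssPart (commute_ssPart (H.commute_coeff j i)).symm

theorem ss_eq_coeff (H : CanonicalForm G k) {i : Fin (k + 1)} (hi : i ≠ 0) :
    H.ss i = H.coeff i :=
  (H.semisimple i hi).isJordanDecomposition.ssPart_eq

theorem coeff_zero_eq (H : CanonicalForm G k) : (H.coeff 0 : Mat N) = H.ss 0 + H.nilRes :=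
  (isJordanDecomposition_parts _).eq_add

/-- Commuting semisimple matrices have semisimple sums, and `H_res` is the only coefficient with a
nilpotent part. -/
theorem isJordanDecomposition_sum (H : CanonicalForm G k) (b : Fin (k + 1) → ℂ) :
    IsJordanDecomposition (∑ i, b i • (H.coeff i : Mat N)) (∑ i, b i • H.ss i)
      (b 0 • H.nilRes) where
  semisimple := IsSemisimpleMat.sum _
    (fun i => (isJordanDecomposition_parts _).semisimple.smul (b i))
    fun i j => ((H.commute_ss i j).smul_left _).smul_right _
  nilpotent := (isJordanDecomposition_parts _).nilpotent.smul _
  commute := Commute.sum_left _ _ _ fun i _ =>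
    ((commute_nilPart (commute_ssPart (H.commute_coeff 0 i)).symm).smul_left _).smul_right _
  eq_add := by
    rw [Fin.sum_univ_succ, Fin.sum_univ_succ (fun i => b i • H.ss i), coeff_zero_eq,
      smul_add]
    simp only [H.ss_eq_coeff (Fin.succ_ne_zero _)]
    abel

end CanonicalForm

/-! ### Partial fractions -/

section PartialFractions

theorem ratFunc_X_sub_C_eq {K : Type*} [Field K] (a : K) :
    (RatFunc.X - RatFunc.C a : RatFunc K) =
      algebraMap (Polynomial K) (RatFunc K) (Polynomial.X - Polynomial.C a) := by
  rw [map_sub, RatFunc.algebraMap_X, RatFunc.algebraMap_C]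

theorem ratFunc_X_sub_C_ne_zero {K : Type*} [Field K] (a : K) :
    (RatFunc.X - RatFunc.C a : RatFunc K) ≠ 0 := by
  rw [ratFunc_X_sub_C_eq, Ne, map_eq_zero_iff _ (RatFunc.algebraMap_injective K)]
  exact Polynomial.X_sub_C_ne_zero a

/-- A submodule with `1 / (X - b)` and the powers of `1 / (X - a)` contains their products. -/
theorem inv_pow_mul_inv_mem {K : Type*} [Field K] {a b : K} (hab : a ≠ b)
    (W : Submodule K (RatFunc K)) (n : ℕ)
    (ha : ∀ i < n, ((RatFunc.X - RatFunc.C a) ^ (i + 1))⁻¹ ∈ W)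
    (hb : (RatFunc.X - RatFunc.C b)⁻¹ ∈ W) :
    ((RatFunc.X - RatFunc.C a) ^ n)⁻¹ * (RatFunc.X - RatFunc.C b)⁻¹ ∈ W := by
  induction n with
  | zero => simpa using hb
  | succ n ih =>
    -- This is `1 / ((X - a)(X - b)) = (a - b)⁻¹ (1 / (X - a) - 1 / (X - b))` divided by `(X - a) ^
    -- n`; it lowers the exponent in the mixed term.
    have key : ((RatFunc.X - RatFunc.C a) ^ (n + 1))⁻¹ * (RatFunc.X - RatFunc.C b)⁻¹ =
        (a - b)⁻¹ • (((RatFunc.X - RatFunc.C a) ^ (n + 1))⁻¹ -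
          ((RatFunc.X - RatFunc.C a) ^ n)⁻¹ * (RatFunc.X - RatFunc.C b)⁻¹) := by
      have h1 := ratFunc_X_sub_C_ne_zero a
      have h2 := ratFunc_X_sub_C_ne_zero b
      have h3 : RatFunc.C a - RatFunc.C b ≠ 0 := by
        rw [← map_sub]
        exact (map_ne_zero _).mpr (sub_ne_zero.mpr hab)
      rw [RatFunc.smul_eq_C_mul, map_inv₀, map_sub]
      field_simp
      ring
    rw [key]
    exact W.smul_mem _ (W.sub_mem (ha n n.lt_succ_self)
      (ih fun i hi => ha i (hi.trans n.lt_succ_self)))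

end PartialFractions

/-! ### Elementary fractions attached to a partition -/

namespace IndexPartition

variable {k : ℕ}

/-- The positions in the parts. -/
abbrev Index (I : IndexPartition k) : Type := Σ j : Fin (I.r + 1), Fin (I.len j + 1)

/-- The element of `{0, …, k}` with the given position. -/
def elem (I : IndexPartition k) (x : I.Index) : Fin (k + 1) := I.idx x.1 x.2

/-- The elementary fractions `1 / (X - a) ^ (ν + 1)` with `a = c_{i_[j,0]}`. -/
noncomputable def frac (I : IndexPartition k) (c : Fin (k + 1) → ℂ) (x : I.Index) : RatFunc ℂ :=
  ((RatFunc.X - RatFunc.C (c (I.idx x.1 0))) ^ ((x.2 : ℕ) + 1))⁻¹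

variable (I : IndexPartition k) {c : Fin (k + 1) → ℂ}

theorem elem_injective : Function.Injective I.elem := I.bijective.1

theorem elem_surjective : Function.Surjective I.elem := I.bijective.2

theorem elem_le_elem {j : Fin (I.r + 1)} {μ ν : Fin (I.len j + 1)} :
    I.elem ⟨j, μ⟩ ≤ I.elem ⟨j, ν⟩ ↔ μ ≤ ν := (I.strictMono j).le_iff_le

theorem elem_zero : I.elem ⟨0, 0⟩ = 0 := by
  obtain ⟨ν, hν⟩ := I.zero_mem
  refine le_antisymm (le_trans (I.elem_le_elem.mpr (Fin.zero_le ν)) (le_of_eq hν)) (Fin.zero_le _)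

variable {I}

theorem apply_idx_zero (hc : c ∈ I.stratum) (x : I.Index) :
    c (I.idx x.1 0) = c (I.elem x) := (hc _ _ _ _).mpr rfl

theorem apply_elem_eq_iff (hc : c ∈ I.stratum) {x y : I.Index} :
    c (I.elem x) = c (I.elem y) ↔ x.1 = y.1 := hc _ _ _ _

/-- In the same part the extra factor raises the pole order by one, and the next position is still
at most that of `x`. In different parts the two poles are distinct, and the product splits into
fractions of no higher order. -/
theorem frac_mul_inv_mem_span (hc : c ∈ I.stratum) {x y : I.Index} (hxy : I.elem y < I.elem x) :
    I.frac c y * (RatFunc.X - RatFunc.C (c (I.elem x)))⁻¹ ∈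
      Submodule.span ℂ (I.frac c '' {z | I.elem z ≤ I.elem x}) := by
  by_cases h : x.1 = y.1
  · obtain ⟨j, μ⟩ := x
    obtain ⟨j', ν⟩ := y
    obtain rfl : j = j' := h
    have hνμ : ν < μ := (I.strictMono j).lt_iff_lt.mp hxy
    have hlt : (ν : ℕ) + 1 < I.len j + 1 := lt_of_le_of_lt (Nat.succ_le_of_lt hνμ) μ.2
    refine Submodule.subset_span ⟨⟨j, ⟨ν + 1, hlt⟩⟩, ?_, ?_⟩
    · exact I.elem_le_elem.mpr (Fin.le_def.mpr (Nat.succ_le_of_lt hνμ))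
    · simp only [frac, ← apply_idx_zero hc ⟨j, μ⟩]
      rw [pow_succ _ ((ν : ℕ) + 1), mul_inv]
  · have hy := apply_idx_zero hc y
    refine inv_pow_mul_inv_mem ?_ _ _ (fun i hi => ?_) ?_
    · rw [hy]
      exact fun h' => h ((apply_elem_eq_iff hc).mp h').symm
    · refine Submodule.subset_span ⟨⟨y.1, ⟨i, hi.trans_le y.2.2⟩⟩, ?_, rfl⟩
      exact le_trans (I.elem_le_elem.mpr (Fin.le_def.mpr (Nat.lt_succ_iff.mp hi))) hxy.le
    · refine Submodule.subset_span ⟨⟨x.1, 0⟩, I.elem_le_elem.mpr (Fin.zero_le x.2), ?_⟩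
      simp [frac, apply_idx_zero hc x]

theorem prod_inv_zero (hc : c ∈ I.stratum) :
    (∏ l ∈ Finset.Iic (0 : Fin (k + 1)), (RatFunc.X - RatFunc.C (c l)))⁻¹ =
      I.frac c ⟨0, 0⟩ := by
  have h : Finset.Iic (0 : Fin (k + 1)) = {0} := by
    ext l
    simp
  rw [h, Finset.prod_singleton, ← I.elem_zero, ← apply_idx_zero hc]
  simp [frac]

/-- The bound `I.elem z ≤ m` is the triangularity; it persists as factors are added one at a time.
-/
theorem prod_inv_mem_span (hc : c ∈ I.stratum) (m : Fin (k + 1)) :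
    (∏ l ∈ Finset.Iic m, (RatFunc.X - RatFunc.C (c l)))⁻¹ ∈
      Submodule.span ℂ (I.frac c '' {z | I.elem z ≤ m}) := by
  induction m using Fin.induction with
  | zero =>
    refine Submodule.subset_span ⟨⟨0, 0⟩, I.elem_zero.le, ?_⟩
    exact (prod_inv_zero hc).symm
  | succ m ih =>
    obtain ⟨x, hx⟩ := I.elem_surjective m.succ
    have h : Finset.Iic m.succ = insert m.succ (Finset.Iic m.castSucc) := by
      ext l
      simp only [Finset.mem_Iic, Finset.mem_insert, Fin.le_def, Fin.ext_iff, Fin.val_succ,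
        Fin.val_castSucc]
      omega
    rw [h, Finset.prod_insert (by simp [Fin.le_def]), mul_inv, mul_comm, ← hx]
    generalize (∏ l ∈ Finset.Iic m.castSucc, (RatFunc.X - RatFunc.C (c l) : RatFunc ℂ))⁻¹ = w at ih
    induction ih using Submodule.span_induction with
    | mem w hw =>
      obtain ⟨y, hy, rfl⟩ := hw
      refine frac_mul_inv_mem_span hc (lt_of_le_of_lt hy ?_)
      rw [hx]
      exact Fin.castSucc_lt_succ
    | zero => rw [zero_mul]; exact Submodule.zero_mem _
    | add u v _ _ hu hv => rw [add_mul]; exact Submodule.add_mem _ hu hv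
    | smul a u _ hu => rw [smul_mul_assoc]; exact Submodule.smul_mem _ _ hu

/-- Partial fraction decomposition of `1 / ((X - c_0) ⋯ (X - c_m))`. -/
theorem exists_prod_inv_eq_sum (hc : c ∈ I.stratum) (m : Fin (k + 1)) :
    ∃ b : I.Index → ℂ, (∀ x, m < I.elem x → b x = 0) ∧
      (∏ l ∈ Finset.Iic m, (RatFunc.X - RatFunc.C (c l)))⁻¹ = ∑ x, b x • I.frac c x := by
  obtain ⟨b, hb, h⟩ := (Finsupp.mem_span_image_iff_linearCombination ℂ).mp (prod_inv_mem_span hc m)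
  refine ⟨b, fun x hx => ?_, ?_⟩
  · by_contra hne
    exact absurd (hb (Finsupp.mem_support_iff.mpr hne)) (not_le.mpr hx)
  · rw [← h, Finsupp.linearCombination_apply, Finsupp.sum_fintype _ _ (by simp)]

/-- The coefficient of `1 / (X - c_0)` in its own partial fraction decomposition. -/
theorem coeff_zero_eq_one (hc : c ∈ I.stratum) {b : I.Index → ℂ}
    (hb : ∀ x, 0 < I.elem x → b x = 0)
    (h : (∏ l ∈ Finset.Iic (0 : Fin (k + 1)), (RatFunc.X - RatFunc.C (c l)))⁻¹ =
      ∑ x, b x • I.frac c x) : b ⟨0, 0⟩ = 1 := by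
  rw [prod_inv_zero hc, Finset.sum_eq_single ⟨0, 0⟩] at h
  · have hne : I.frac c ⟨0, 0⟩ ≠ 0 :=
      inv_ne_zero (pow_ne_zero _ (ratFunc_X_sub_C_ne_zero _))
    exact smul_left_injective ℂ hne (h.symm.trans (one_smul ℂ _).symm)
  · intro x _ hx
    rw [hb x (Fin.pos_iff_ne_zero.mpr fun h0 => hx (I.elem_injective (h0.trans I.elem_zero.symm))),
      zero_smul]
  · simp

/-- Indices of the factors of `(X - c_0) ⋯ (X - c_d)` that cancel against `I.frac c x`. -/
def cancel (I : IndexPartition k) (x : I.Index) : Finset (Fin (k + 1)) :=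
  (Finset.Iic x.2).image (I.idx x.1)

theorem elem_mem_cancel {x y : I.Index} : I.elem x ∈ I.cancel y ↔
    x.1 = y.1 ∧ I.elem x ≤ I.elem y := by
  simp only [cancel, Finset.mem_image, Finset.mem_Iic]
  constructor
  · rintro ⟨ν, hν, h⟩
    obtain rfl : (⟨y.1, ν⟩ : I.Index) = x := I.elem_injective h
    exact ⟨rfl, I.elem_le_elem.mpr hν⟩
  · obtain ⟨j, μ⟩ := x
    rintro ⟨rfl, h⟩
    exact ⟨μ, I.elem_le_elem.mp h, rfl⟩

/-- The `x.2 + 1` indices in `I.cancel x` share one value of `c`, so the denominator of `I.frac c x`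
is exactly their subproduct. -/
theorem frac_mul_prod (hc : c ∈ I.stratum) {d : Fin (k + 1)} {x : I.Index} (hx : I.elem x ≤ d) :
    I.frac c x * ∏ l ∈ Finset.Iic d, (RatFunc.X - RatFunc.C (c l)) =
      algebraMap (Polynomial ℂ) (RatFunc ℂ)
        (∏ l ∈ Finset.Iic d \ I.cancel x, (Polynomial.X - Polynomial.C (c l))) := by
  have hsub : I.cancel x ⊆ Finset.Iic d := by
    intro l hl
    obtain ⟨y, rfl⟩ := I.elem_surjective l
    exact Finset.mem_Iic.mpr ((elem_mem_cancel.mp hl).2.trans hx)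
  have hprod : ∏ l ∈ I.cancel x, (RatFunc.X - RatFunc.C (c l)) =
      (RatFunc.X - RatFunc.C (c (I.idx x.1 0))) ^ ((x.2 : ℕ) + 1) := by
    have h : ∀ l ∈ I.cancel x, (RatFunc.X - RatFunc.C (c l)) =
        (RatFunc.X - RatFunc.C (c (I.idx x.1 0))) := by
      intro l hl
      obtain ⟨y, rfl⟩ := I.elem_surjective l
      rw [apply_idx_zero hc x, (apply_elem_eq_iff hc).mpr (elem_mem_cancel.mp hl).1]
    rw [Finset.prod_congr rfl h, Finset.prod_const, cancel,
      Finset.card_image_of_injective _ (I.strictMono _).injective, Fin.card_Iic]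
  rw [← Finset.prod_sdiff hsub, hprod, frac, mul_comm, mul_assoc, mul_inv_cancel₀, mul_one,
    map_prod]
  · simp only [ratFunc_X_sub_C_eq]
  · exact pow_ne_zero _ (ratFunc_X_sub_C_ne_zero _)

/-- The leading coefficient at a pole of a sum of partial fractions. -/
theorem eval_numerator (hc : c ∈ I.stratum) {d : Fin (k + 1)} {b : I.Index → ℂ}
    (hb : ∀ y, d < I.elem y → b y = 0) {P : Polynomial ℂ}
    (h : ∑ y, b y • I.frac c y = algebraMap (Polynomial ℂ) (RatFunc ℂ) P *
      (∏ l ∈ Finset.Iic d, (RatFunc.X - RatFunc.C (c l)))⁻¹)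
    {x : I.Index} (hx : I.elem x ≤ d)
    (hmax : ∀ y : I.Index, y.1 = x.1 → I.elem y ≤ d → I.elem y ≤ I.elem x) :
    P.eval (c (I.elem x)) =
      b x * ∏ l ∈ Finset.Iic d \ I.cancel x, (c (I.elem x) - c l) := by
  have hP : P = ∑ y, Polynomial.C (b y) *
      ∏ l ∈ Finset.Iic d \ I.cancel y, (Polynomial.X - Polynomial.C (c l)) := by
    apply RatFunc.algebraMap_injective ℂ
    have hD : ∏ l ∈ Finset.Iic d, (RatFunc.X - RatFunc.C (c l) : RatFunc ℂ) ≠ 0 :=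
      Finset.prod_ne_zero_iff.mpr fun l _ => ratFunc_X_sub_C_ne_zero _
    rw [← mul_inv_cancel_right₀ hD (algebraMap _ _ P), mul_right_comm, ← h, Finset.sum_mul,
      map_sum]
    refine Finset.sum_congr rfl fun y _ => ?_
    by_cases hy : I.elem y ≤ d
    · rw [smul_mul_assoc, frac_mul_prod hc hy, map_mul, RatFunc.algebraMap_C,
        RatFunc.smul_eq_C_mul]
    · simp [hb y (not_le.mp hy)]
  -- For `y ≠ x` with `I.elem y ≤ d` the factor at `I.elem x` is not cancelled, since otherwise `y`
  -- would lie in the part of `x` at or beyond `x`, against maximality. So that term vanishes at `c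
  -- (I.elem x)`.
  rw [hP, Polynomial.eval_finsetSum, Finset.sum_eq_single x]
  · simp [Polynomial.eval_prod]
  · intro y _ hyx
    by_cases hy : I.elem y ≤ d
    · rw [Polynomial.eval_mul, Polynomial.eval_prod]
      refine mul_eq_zero_of_right _ (Finset.prod_eq_zero (i := I.elem x) ?_ (by simp))
      refine Finset.mem_sdiff.mpr ⟨Finset.mem_Iic.mpr hx, fun hmem => hyx ?_⟩
      obtain ⟨h1, h2⟩ := elem_mem_cancel.mp hmem
      exact I.elem_injective (le_antisymm (hmax y h1.symm hy) h2)
    · simp [hb y (not_le.mp hy)]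
  · simp

/-- By maximality `I.cancel x` exhausts the part of `x` up to `d`; the remaining indices lie in
other parts. -/
theorem prod_sub_ne_zero (hc : c ∈ I.stratum) {d : Fin (k + 1)} {x : I.Index}
    (hmax : ∀ y : I.Index, y.1 = x.1 → I.elem y ≤ d → I.elem y ≤ I.elem x) :
    ∏ l ∈ Finset.Iic d \ I.cancel x, (c (I.elem x) - c l) ≠ 0 := by
  refine Finset.prod_ne_zero_iff.mpr fun l hl => sub_ne_zero.mpr fun h => ?_
  obtain ⟨y, rfl⟩ := I.elem_surjective l
  obtain ⟨h1, h2⟩ := Finset.mem_sdiff.mp hl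
  have hxy := (apply_elem_eq_iff hc).mp h
  exact h2 (elem_mem_cancel.mpr ⟨hxy.symm, hmax y hxy.symm (Finset.mem_Iic.mp h1)⟩)

/-- In a nontrivial relation, take the largest index with nonzero coefficient as `d` in
`eval_numerator`: the zero numerator would have a nonzero value. -/
theorem linearIndependent_frac (hc : c ∈ I.stratum) : LinearIndependent ℂ (I.frac c) := by
  rw [Fintype.linearIndependent_iff]
  intro b hb x
  by_contra hx
  obtain ⟨z, hz, hzmax⟩ := Finset.exists_max_image (Finset.univ.filter fun y => b y ≠ 0) I.elem
    ⟨x, by simpa using hx⟩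
  have hz' : b z ≠ 0 := by simpa using hz
  have hmax : ∀ y : I.Index, y.1 = z.1 → I.elem y ≤ I.elem z → I.elem y ≤ I.elem z :=
    fun _ _ h => h
  have h := eval_numerator (P := 0) hc (d := I.elem z) (b := b) (fun y hy => by
    by_contra hne
    exact absurd (hzmax y (by simpa using hne)) (not_le.mpr hy)) (by simpa using hb) le_rfl hmax
  rw [Polynomial.eval_zero] at h
  exact mul_ne_zero hz' (prod_sub_ne_zero hc hmax) h.symm

/-- Linear functionals separate the points of `M` and reduce the claim to scalar relations. -/
theorem sum_tmul_frac_injective (hc : c ∈ I.stratum) {M : Type*} [AddCommGroup M] [Module ℂ M]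
    {A B : I.Index → M} (h : ∑ x, A x ⊗ₜ[ℂ] I.frac c x = ∑ x, B x ⊗ₜ[ℂ] I.frac c x) : A = B := by
  funext x
  rw [← sub_eq_zero, ← Module.forall_dual_apply_eq_zero_iff ℂ]
  intro φ
  have h1 := congrArg (TensorProduct.lid ℂ (RatFunc ℂ) ∘ LinearMap.rTensor (RatFunc ℂ) φ) h
  simp only [Function.comp_apply, map_sum, LinearMap.rTensor_tmul, TensorProduct.lid_tmul] at h1
  rw [← sub_eq_zero, ← Finset.sum_sub_distrib] at h1
  simp only [← sub_smul] at h1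
  rw [map_sub]
  exact Fintype.linearIndependent_iff.mp (linearIndependent_frac hc) _ h1 x

end IndexPartition

end Unfolding

/-! ### The components of the unfolding and their chains -/

namespace Unfolding.CanonicalForm

variable {N : ℕ} {G : Subgroup (GL (Fin N) ℂ)} {k : ℕ} (H : CanonicalForm G k)
  {I : IndexPartition k} (b : Fin (k + 1) → I.Index → ℂ)

theorem coe_sum_smul_coeff (x : I.Index) :
    ((∑ m, b m x • H.coeff m : lieAlg G) : Mat N) = ∑ m, b m x • (H.coeff m : Mat N) :=
  map_sum (lieAlg G).subtype _ _

/-- The canonical form at the pole of the part `I_j` whose coefficients are given by the partial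
fraction coefficients `b`. -/
def component (hb : ∀ x, 0 < I.elem x → b 0 x = 0) (j : Fin (I.r + 1)) :
    CanonicalForm G (I.len j) where
  coeff ν := ∑ m, b m ⟨j, ν⟩ • H.coeff m
  semisimple ν hν := by
    have hpos : 0 < I.elem ⟨j, ν⟩ :=
      lt_of_le_of_lt (Fin.zero_le _) (I.strictMono j (Fin.pos_iff_ne_zero.mpr hν))
    have h := H.isJordanDecomposition_sum fun m => b m ⟨j, ν⟩
    -- Off the position of index `0` the matrix `H_res` has weight zero, so no nilpotent part
    -- remains.
    rw [coe_sum_smul_coeff, h.eq_add, hb _ hpos, zero_smul, add_zero]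
    exact h.semisimple
  lie_eq_zero μ ν := by
    refine Subtype.ext ?_
    rw [LieSubalgebra.coe_bracket, LieRing.of_associative_ring_bracket, coe_sum_smul_coeff,
      coe_sum_smul_coeff]
    exact sub_eq_zero.mpr (Commute.sum_left _ _ _ fun m _ => Commute.sum_right _ _ _ fun n _ =>
      ((H.commute_coeff m n).smul_left _).smul_right _)

variable {b} (hb : ∀ x, 0 < I.elem x → b 0 x = 0)

theorem component_ss (j : Fin (I.r + 1)) (ν : Fin (I.len j + 1)) :
    (H.component b hb j).ss ν = ∑ m, b m ⟨j, ν⟩ • H.ss m := by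
  rw [ss, component, coe_sum_smul_coeff]
  exact (H.isJordanDecomposition_sum fun m => b m ⟨j, ν⟩).ssPart_eq

theorem component_nilRes (j : Fin (I.r + 1)) :
    (H.component b hb j).nilRes = b 0 ⟨j, 0⟩ • H.nilRes := by
  rw [nilRes, component, coe_sum_smul_coeff]
  exact (H.isJordanDecomposition_sum fun m => b m ⟨j, 0⟩).nilPart_eq

theorem component_isIn {t : LieSubalgebra ℂ (Mat N)} (hH : H.IsIn t) (j : Fin (I.r + 1)) : (H.component b hb j).IsIn t := by
  intro ν
  rw [component_ss]
  exact t.toSubmodule.sum_mem fun m _ => t.smul_mem _ (hH m)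

variable {t : LieSubalgebra ℂ (Mat N)} (hH : H.IsIn t)

theorem component_rootVal (j : Fin (I.r + 1)) (α : Module.Dual ℂ t) (ν : Fin (I.len j + 1)) :
    (H.component b hb j).rootVal (H.component_isIn hb hH j) α ν =
      ∑ m, b m ⟨j, ν⟩ * H.rootVal hH α m := by
  have h : (⟨(H.component b hb j).ss ν, H.component_isIn hb hH j ν⟩ : t) =
      ∑ m, b m ⟨j, ν⟩ • (⟨H.ss m, hH m⟩ : t) := by
    refine Subtype.ext ((H.component_ss hb j ν).trans ?_)
    exact (map_sum t.subtype (fun m => b m ⟨j, ν⟩ • (⟨H.ss m, hH m⟩ : t)) _).symm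
  rw [rootVal, h, map_sum]
  simp only [map_smul, smul_eq_mul, rootVal]

theorem sum_principalPart (B : ∀ j : Fin (I.r + 1), Fin (I.len j + 1) → lieAlg G)
    (c : Fin (k + 1) → ℂ) :
    ∑ j, principalPart (B j) (c (I.idx j 0)) = ∑ x : I.Index, B x.1 x.2 ⊗ₜ[ℂ] I.frac c x := by
  rw [Fintype.sum_sigma]
  rfl

theorem unfold_eq_sum_principalPart {c : Fin (k + 1) → ℂ}
    (hbc : ∀ m, (∏ l ∈ Finset.Iic m, (RatFunc.X - RatFunc.C (c l)))⁻¹ =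
      ∑ x, b m x • I.frac c x) :
    H.unfold c = ∑ j, principalPart (H.component b hb j).coeff (c (I.idx j 0)) := by
  rw [sum_principalPart, unfold]
  simp only [component, hbc, TensorProduct.tmul_sum, TensorProduct.sum_tmul]
  rw [Finset.sum_comm]
  simp only [TensorProduct.tmul_smul, TensorProduct.smul_tmul']

/-- The simple roots that vanish on the coefficients of order at least `ν` of the component at the
part `I_j` are those that vanish on all `H_m` with `i_[j,ν] ≤ m`. -/
theorem component_chain {c : Fin (k + 1) → ℂ} {Δ : Set (Module.Dual ℂ t)}
    (hcB : c ∈ H.paramSpace hH Δ) (hcI : c ∈ I.stratum)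
    (hbm : ∀ m x, m < I.elem x → b m x = 0)
    (hbc : ∀ m, (∏ l ∈ Finset.Iic m, (RatFunc.X - RatFunc.C (c l)))⁻¹ =
      ∑ x, b m x • I.frac c x) (j : Fin (I.r + 1)) (ν : Fin (I.len j + 1)) :
    (H.component b hb j).chain (H.component_isIn hb hH j) Δ ν = H.chain hH Δ (I.idx j ν) := by
  ext α
  refine and_congr_right fun hα => ⟨fun h => ?_, fun h μ hμ => ?_⟩
  · by_contra hne
    push Not at hne
    obtain ⟨m, hm, hm0⟩ := hne
    -- This `d` is `d(α)`, the last index with `α(H_d) ≠ 0`.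
    obtain ⟨d, hd, hdmax⟩ := Finset.exists_max_image
      (Finset.univ.filter fun m => H.rootVal hH α m ≠ 0) id ⟨m, by simpa using hm0⟩
    have hd0 : H.rootVal hH α d ≠ 0 := by simpa using hd
    have hvan : ∀ m, d < m → H.rootVal hH α m = 0 := fun m hdm => by
      by_contra hne
      exact absurd (hdmax m (by simpa using hne)) (not_le.mpr hdm)
    have hνd : I.idx j ν ≤ d := hm.trans (hdmax m (by simpa using hm0))
    -- The position of the highest pole order that the denominator `(z - c_0) ⋯ (z - c_d)` allows at
    -- this point.
    obtain ⟨μ, hμ, hμmax⟩ := Finset.exists_max_image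
      (Finset.univ.filter fun μ => I.idx j μ ≤ d) id ⟨ν, by simpa using hνd⟩
    have hμd : I.elem ⟨j, μ⟩ ≤ d := (Finset.mem_filter.mp hμ).2
    have hνμ : ν ≤ μ := hμmax ν (by simpa using hνd)
    have hmax : ∀ y : I.Index, y.1 = j → I.elem y ≤ d → I.elem y ≤ I.elem ⟨j, μ⟩ := by
      rintro ⟨_, κ⟩ rfl hy
      exact I.elem_le_elem.mpr (hμmax κ (Finset.mem_filter.mpr ⟨Finset.mem_univ κ, hy⟩))
    have hnot : α ∉ H.chain hH Δ 0 := fun h0 => hd0 (h0.2 d (Fin.zero_le d))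
    have hgr : IsGreatest {i | α ∉ H.chain hH Δ i} d := by
      refine ⟨fun hd' => hd0 (hd'.2 d le_rfl), fun i hi => ?_⟩
      by_contra hdi
      exact hi ⟨hα, fun m hm => hvan m ((not_le.mp hdi).trans_le hm)⟩
    refine hcB α ⟨hα, hnot⟩ d hgr (I.elem ⟨j, μ⟩) hμd ?_
    -- Both sides are `α` applied to the semisimple part of `H(c)`: in partial fractions, and over a
    -- common denominator.
    have hsum : ∑ y, (∑ m, b m y * H.rootVal hH α m) • I.frac c y =
        algebraMap (Polynomial ℂ) (RatFunc ℂ) (∑ m ∈ Finset.Iic d,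
          Polynomial.C (H.rootVal hH α m) *
            ∏ l ∈ Finset.Ioc m d, (Polynomial.X - Polynomial.C (c l))) *
        (∏ l ∈ Finset.Iic d, (RatFunc.X - RatFunc.C (c l)))⁻¹ := by
      have h1 : ∑ y, (∑ m, b m y * H.rootVal hH α m) • I.frac c y =
          ∑ m, H.rootVal hH α m • (∏ l ∈ Finset.Iic m, (RatFunc.X - RatFunc.C (c l)))⁻¹ := by
        simp only [hbc, Finset.sum_smul, Finset.smul_sum]
        rw [Finset.sum_comm]
        simp only [smul_smul, mul_comm]
      rw [h1, map_sum, Finset.sum_mul, ← Finset.sum_subset (Finset.subset_univ (Finset.Iic d))]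
      · refine Finset.sum_congr rfl fun m hm => ?_
        have hsplit : Finset.Iic d = Finset.Iic m ∪ Finset.Ioc m d :=
          (Finset.Iic_union_Ioc_eq_Iic (Finset.mem_Iic.mp hm)).symm
        have hdisj : Disjoint (Finset.Iic m) (Finset.Ioc m d) :=
          Finset.disjoint_left.mpr fun l h1 h2 =>
            absurd (Finset.mem_Iic.mp h1) (not_le.mpr (Finset.mem_Ioc.mp h2).1)
        have hprod : ∏ l ∈ Finset.Ioc m d, (RatFunc.X - RatFunc.C (c l) : RatFunc ℂ) ≠ 0 :=
          Finset.prod_ne_zero_iff.mpr fun l _ => ratFunc_X_sub_C_ne_zero _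
        rw [hsplit, Finset.prod_union hdisj, map_mul, map_prod, RatFunc.algebraMap_C,
          RatFunc.smul_eq_C_mul, mul_inv]
        simp only [← ratFunc_X_sub_C_eq]
        rw [mul_assoc, mul_comm (∏ l ∈ Finset.Ioc m d, _), mul_assoc, inv_mul_cancel₀ hprod,
          mul_one]
      · intro m _ hm
        rw [hvan m (by simpa using hm), zero_smul]
    have heval := IndexPartition.eval_numerator hcI (fun y hy => Finset.sum_eq_zero fun m _ => by
      rcases le_or_gt m d with hm | hm
      · rw [hbm m y (hm.trans_lt hy), zero_mul]
      · rw [hvan m hm, mul_zero]) hsum hμd hmax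
    have hzero := h μ hνμ
    rw [H.component_rootVal hb hH] at hzero
    rw [hzero, zero_mul, Polynomial.eval_finsetSum] at heval
    rw [unfoldPoly, ← heval]
    simp only [Polynomial.eval_mul, Polynomial.eval_C, Polynomial.eval_prod, Polynomial.eval_sub,
      Polynomial.eval_X]
    -- At `z = c_i` with `i = i_[j,μ]`, the terms with `m < i` contain the factor `z - c_i`; the
    -- others form `f_α^{(i)}(c)`.
    refine Finset.sum_subset (fun m hm => Finset.mem_Iic.mpr (Finset.mem_Icc.mp hm).2)
      fun m hm hm' => mul_eq_zero_of_right _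
        (Finset.prod_eq_zero (i := I.elem ⟨j, μ⟩) (Finset.mem_Ioc.mpr ⟨?_, hμd⟩) (sub_self _))
    by_contra hle
    exact hm' (Finset.mem_Icc.mpr ⟨not_lt.mp hle, Finset.mem_Iic.mp hm⟩)
  · rw [H.component_rootVal hb hH]
    refine Finset.sum_eq_zero fun m _ => ?_
    rcases lt_or_ge m (I.elem ⟨j, μ⟩) with hm | hm
    · rw [hbm m _ hm, zero_mul]
    · rw [h m (le_trans (I.elem_le_elem.mpr hμ) hm), mul_zero]

end Unfolding.CanonicalForm

/-! ### The decomposition and the spectral types -/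

theorem corollary5 {N : ℕ} (G : Subgroup (GL (Fin N) ℂ)) (hG : Unfolding.IsConnectedReductive G)
    {k : ℕ} (H : Unfolding.CanonicalForm G k)
    (t : LieSubalgebra ℂ (Unfolding.Mat N)) (ht : Unfolding.IsMaximalToral G t) (hH : H.IsIn t)
    (Δ : Set (Module.Dual ℂ t)) (hΔ : Unfolding.IsSimpleSystem G t Δ)
    (hnorm : H.IsNormalized hH Δ)
    (I : Unfolding.IndexPartition k) (c : Fin (k + 1) → ℂ)
    (hcB : c ∈ H.paramSpace hH Δ) (hcI : c ∈ I.stratum) :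
    -- the components `H(c)_j`, which are canonical forms at the points `c_{i_[j,0]}`
    ∃ K : ∀ j : Fin (I.r + 1), Unfolding.CanonicalForm G (I.len j),
      -- the partial fraction decomposition of `H(c)`
      H.unfold c = ∑ j, Unfolding.principalPart (K j).coeff (c (I.idx j 0)) ∧
      -- its coefficients are unique
      (∀ A : ∀ j : Fin (I.r + 1), Fin (I.len j + 1) → Unfolding.lieAlg G,
        H.unfold c = ∑ j, Unfolding.principalPart (A j) (c (I.idx j 0)) →
          ∀ j, A j = (K j).coeff) ∧
      -- the spectral types of the components
      ∀ j, ∃ hK : (K j).IsIn t,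
        (K j).spectralType hK Δ =
          if j = 0 then
            Unfolding.spectralTypeMk G Δ (fun ν => H.chain hH Δ (I.idx j ν)) H.nilRes
          else
            Unfolding.spectralTypeMk G Δ (fun ν => H.chain hH Δ (I.idx j ν)) 0 := by
  choose b hbm hbc using fun m => Unfolding.IndexPartition.exists_prod_inv_eq_sum (I := I) hcI m
  have hb : ∀ x, 0 < I.elem x → b 0 x = 0 := hbm 0
  have hdec := H.unfold_eq_sum_principalPart hb hbc
  refine ⟨H.component b hb, hdec, fun A hA j => ?_, fun j => ⟨H.component_isIn hb hH j, ?_⟩⟩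
  · rw [hdec, Unfolding.CanonicalForm.sum_principalPart fun j => (H.component b hb j).coeff,
      Unfolding.CanonicalForm.sum_principalPart] at hA
    funext ν
    exact (congrFun (Unfolding.IndexPartition.sum_tmul_frac_injective hcI hA) ⟨j, ν⟩).symm
  · have hchain : (H.component b hb j).chain (H.component_isIn hb hH j) Δ =
        fun ν => H.chain hH Δ (I.idx j ν) :=
      funext fun ν => H.component_chain hb hH hcB hcI hbm hbc j ν
    -- The chain also determines the Levi subgroup, so only the nilpotent representatives remain to
    -- be compared.
    rw [Unfolding.CanonicalForm.spectralType, hchain, Unfolding.CanonicalForm.component_nilRes]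
    split_ifs with hj
    · subst hj
      rw [Unfolding.IndexPartition.coeff_zero_eq_one hcI hb (hbc 0), one_smul]
    · have hpos : 0 < I.elem ⟨j, 0⟩ := Fin.pos_iff_ne_zero.mpr fun h0 =>
        hj (congrArg Sigma.fst (I.elem_injective (h0.trans I.elem_zero.symm)))
      rw [hb _ hpos, zero_smul]
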